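/- **Setting.** For each $n$ let $(X_1,\dots,X_n)$ have a joint density $f_n(x_1,\dots,x_n\mid\theta)$ with respect to a dominating measure, where the parameter space $\Theta\subset\mathbb{R}^p$ is a rectangle (a product of intervals), and let $\theta$, the true parameter, be an interior point of $\Theta$. Expectations, probabilities, $O_p$ and "almost surely" refer to this $\theta$. Let $\ell_n(\theta)=\log f_n(X_1,\dots,X_n\mid\theta)$, let $\hat\theta^{ML}$ be the maximum likelihood estimator (an interior maximizer of the likelihood solving $\partial\ell_n/\partial\theta=0$), and for a (possibly improper, possibly $n$-dependent) prior density $\pi\ge 0$ on $\Theta$ with $\pi(\theta)>0$ let $$\hat\theta^{B}=\frac{\int_\Theta \tau\,\pi(\tau)f_n(X_1,\dots,X_n\mid\tau)\,d\tau}{\int_\Theta \pi(\tau)f_n(X_1,\dots,X_n\mid\tau)\,d\tau}$$ be the posterior mean. Put $H_n(\theta)=-n^{-1}\partial^2\ell_n(\theta)/\partial\theta\,\partial\theta^{T}$, write $H_n^{rs}$ for the entries of $H_n^{-1}$, and $$I_{n,rs}=\frac1n\frac{\partial\ell_n}{\partial\theta_r}\frac{\partial\ell_n}{\partial\theta_s},\qquad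 J_{n,rs,t}=\frac1n\frac{\partial^2\ell_n}{\partial\theta_r\partial\theta_s}\frac{\partial\ell_n}{\partial\theta_t},\qquad K_{n,rst}=\frac1n\frac{\partial^3\ell_n}{\partial\theta_r\partial\theta_s\partial\theta_t},$$ $$A_{n,rsv}=K_{n,vrs}+2J_{n,vr,s}+\sum_{t=1}^p\sum_{u=1}^pH_n^{tu}I_{n,su}K_{n,rtv},\qquad A_{n,rs}=(A_{n,rsv})_{v=1}^p .$$ **Assumptions.** (i) $\hat\theta^{ML}-\theta=O_p(n^{-1/2})$; (ii) $\ell_n(\theta)=O_p(n)$; (iii) for all large $n$, almost surely $f_n>0$ on the interior of $\Theta$ and $\ell_n$ is three times continuously differentiable there; (iv) $\pi$ is differentiable on the interior of $\Theta$; (v) for all large $n$, $H_n(\theta)$ is almost surely invertible, and with probability tending to one $\hat\theta^{ML}$ exists and $H_n(\hat\theta^{ML})$ is positive definite. Moreover, for all large $n$ the posterior is almost surely proper with finite mean, $\hat\theta^B$ has an expectation, and the remainder $$R_n=\hat\theta^B-\theta-n^{-1}H_n^{-1}(\theta)\Big[\frac{\partial}{\partial\theta}\{\log\pi(\theta)+2\ell_n(\theta)\}+\frac12\sum_{r,s=1}^pH_n^{rs}(\theta)A_{n,rs}(\theta)\Big]$$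 has an expectation, with $E(R_n)=o(n^{-1})$. **Conclusions.** (a) As $n\to\infty$, the expectation on the right existing for all large $n$, $$E(\hat\theta^B)-\theta=n^{-1}E\Big(H_n^{-1}(\theta)\Big[\frac{\partial}{\partial\theta}\{\log\pi(\theta)+2\ell_n(\theta)\}+\frac12\sum_{r,s=1}^pH_n^{rs}(\theta)A_{n,rs}(\theta)\Big]\Big)+o(n^{-1}).$$ (b) Suppose in addition that $H_n$ is non-stochastic: for all large $n$ and every $\tau$ in the interior of $\Theta$, $H_n(\tau)$ is almost surely equal to a matrix not depending on the data. Then for all large $n$ the $K_{n,rst}(\theta)$ are non-stochastic too, the variables $I_{n,rs}(\theta)$, $J_{n,rs,t}(\theta)$, $A_{n,rsv}(\theta)$ are integrable, and $$E(\hat\theta^B)-\theta=n^{-1}H_n^{-1}(\theta)\Big[\frac{\partial\log\pi(\theta)}{\partial\theta}+\frac12\sum_{r,s=1}^pH_n^{rs}(\theta)E\{A_{n,rs}(\theta)\}\Big]+o(n^{-1}),$$ where $$E\{A_{n,rsv}(\theta)\}=K_{n,vrs}(\theta)+2E\{J_{n,vr,s}(\theta)\}+\sum_{t=1}^p\sum_{u=1}^pH_n^{tu}(\theta)E\{I_{n,su}(\theta)\}K_{n,rtv}(\theta).$$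 Consequently, if for all large $n$ the prior satisfies at $\theta$ the ($n$-dependent) equation $$\frac{\partial\log\pi(\theta)}{\partial\theta}=-\frac12\sum_{r,s=1}^pH_n^{rs}(\theta)E\{A_{n,rs}(\theta)\},$$ then the posterior mean is second-order unbiased at $\theta$: $E(\hat\theta^B)-\theta=o(n^{-1})$. -/

import Mathlib

open MeasureTheory Filter Topology Asymptotics

noncomputable section

/-- `Y n = O_p(a n)` when `Y n` is a random element on its own probability space `(Ω n, P n)`:
the ratios `‖Y n‖ / |a n|` are (eventually) uniformly tight. -/
def IsBigOInProb {Ω : ℕ → Type*} [∀ n, MeasurableSpace (Ω n)] {E : Type*} [Norm E]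
    (P : ∀ n, Measure (Ω n)) (Y : ∀ n, Ω n → E) (a : ℕ → ℝ) : Prop :=
  ∀ ε : ℝ, 0 < ε → ∃ C : ℝ, ∀ᶠ n in atTop,
    P n {x | C * |a n| < ‖Y n x‖} ≤ ENNReal.ofReal ε

/-- The partial derivative `∂g/∂θ_r` at `θ`. -/
def pd {p : ℕ} (r : Fin p) (g : (Fin p → ℝ) → ℝ) (θ : Fin p → ℝ) : ℝ :=
  fderiv ℝ g θ (Pi.single r 1)

/-- A parametric model: for every sample size `n` the data `(X₁, …, X_n)` have a joint density
`f n θ` with respect to a dominating measure `μ n`; the parameter space `Θ` is a rectangle in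
`ℝ^p`, a product of (bounded or unbounded, open or closed) intervals. -/
structure ParamModel (𝒳 : Type*) [MeasurableSpace 𝒳] (p : ℕ) where
  Θ : Set (Fin p → ℝ)
  rectangle : ∃ S : Fin p → Set ℝ, (∀ i, (S i).OrdConnected) ∧ Θ = Set.univ.pi S
  μ : ∀ n : ℕ, Measure (Fin n → 𝒳)
  f : ∀ n : ℕ, (Fin p → ℝ) → (Fin n → 𝒳) → ℝ
  f_nonneg : ∀ n, ∀ θ ∈ Θ, ∀ x, 0 ≤ f n θ x
  f_measurable : ∀ n, ∀ θ ∈ Θ, Measurable (f n θ)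
  f_lintegral : ∀ n, ∀ θ ∈ Θ, ∫⁻ x, ENNReal.ofReal (f n θ x) ∂(μ n) = 1

namespace ParamModel

variable {𝒳 : Type*} [MeasurableSpace 𝒳] {p : ℕ} (M : ParamModel 𝒳 p)

/-- The law of `(X₁, …, X_n)` under the parameter `θ`. -/
def law (θ : Fin p → ℝ) (n : ℕ) : Measure (Fin n → 𝒳) :=
  (M.μ n).withDensity fun x => ENNReal.ofReal (M.f n θ x)

/-- The log-likelihood `ℓ_n(θ)` for the data `x`. -/
def logLik (n : ℕ) (x : Fin n → 𝒳) (θ : Fin p → ℝ) : ℝ :=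
  Real.log (M.f n θ x)

/-- `H_n(θ) = -n⁻¹ ∂²ℓ_n(θ)/∂θ∂θᵀ`. -/
def H (n : ℕ) (x : Fin n → 𝒳) (θ : Fin p → ℝ) : Matrix (Fin p) (Fin p) ℝ :=
  Matrix.of fun r s => -((n : ℝ)⁻¹ * pd r (pd s (M.logLik n x)) θ)

/-- `I_{n,rs}(θ)`. -/
def I (n : ℕ) (x : Fin n → 𝒳) (θ : Fin p → ℝ) (r s : Fin p) : ℝ :=
  (n : ℝ)⁻¹ * (pd r (M.logLik n x) θ * pd s (M.logLik n x) θ)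

/-- `J_{n,rs,t}(θ)`. -/
def J (n : ℕ) (x : Fin n → 𝒳) (θ : Fin p → ℝ) (r s t : Fin p) : ℝ :=
  (n : ℝ)⁻¹ * (pd r (pd s (M.logLik n x)) θ * pd t (M.logLik n x) θ)

/-- `K_{n,rst}(θ)`. -/
def K (n : ℕ) (x : Fin n → 𝒳) (θ : Fin p → ℝ) (r s t : Fin p) : ℝ :=
  (n : ℝ)⁻¹ * pd r (pd s (pd t (M.logLik n x))) θ

/-- `A_{n,rsv}(θ)`, the `v`-th entry of the vector `A_{n,rs}(θ)`. -/
def A (n : ℕ) (x : Fin n → 𝒳) (θ : Fin p → ℝ) (r s v : Fin p) : ℝ :=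
  M.K n x θ v r s + 2 * M.J n x θ v r s
    + ∑ t, ∑ u, (M.H n x θ)⁻¹ t u * M.I n x θ s u * M.K n x θ r t v

/-- The posterior mean `θ̂^B` for the (possibly improper) prior density `π`. -/
def bayes (π : (Fin p → ℝ) → ℝ) (n : ℕ) (x : Fin n → 𝒳) : Fin p → ℝ := fun v =>
  (∫ τ in M.Θ, τ v * (π τ * M.f n τ x)) / ∫ τ in M.Θ, π τ * M.f n τ x

/-- For the data `x` the posterior is proper and has a finite mean. -/
structure PosteriorMeanExists (π : (Fin p → ℝ) → ℝ) (n : ℕ) (x : Fin n → 𝒳) : Prop where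
  integrable : IntegrableOn (fun τ => π τ * M.f n τ x) M.Θ
  pos : 0 < ∫ τ in M.Θ, π τ * M.f n τ x
  integrable_mean : ∀ v, IntegrableOn (fun τ => τ v * (π τ * M.f n τ x)) M.Θ

/-- The random vector
`H_n⁻¹(θ) [∂/∂θ {log π(θ) + 2 ℓ_n(θ)} + ½ ∑_r ∑_s H_n^{rs}(θ) A_{n,rs}(θ)]`. -/
def lead (π : (Fin p → ℝ) → ℝ) (θ : Fin p → ℝ) (n : ℕ) (x : Fin n → 𝒳) : Fin p → ℝ :=
  (M.H n x θ)⁻¹.mulVec fun v =>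
    pd v (fun τ => Real.log (π τ) + 2 * M.logLik n x τ) θ
      + 1 / 2 * ∑ r, ∑ s, (M.H n x θ)⁻¹ r s * M.A n x θ r s v

/-- The remainder in the expansion `θ̂^B = θ + n⁻¹ lead + remainder`. -/
def remainder (π : (Fin p → ℝ) → ℝ) (θ : Fin p → ℝ) (n : ℕ) (x : Fin n → 𝒳) : Fin p → ℝ :=
  M.bayes π n x - (θ + (n : ℝ)⁻¹ • M.lead π θ n x)

/-- The bias `E_θ(θ̂^B) - θ` of the posterior mean at sample size `n`. -/
def bias (π : (Fin p → ℝ) → ℝ) (θ : Fin p → ℝ) (n : ℕ) : Fin p → ℝ :=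
  (∫ x, M.bayes π n x ∂(M.law θ n)) - θ

/-- The posterior means (for priors that may depend on `n`) are second-order unbiased at `θ`:
their bias is `o(n⁻¹)`. -/
def SecondOrderUnbiasedAt (π : ℕ → (Fin p → ℝ) → ℝ) (θ : Fin p → ℝ) : Prop :=
  (fun n => M.bias (π n) θ n) =o[atTop] fun n : ℕ => (n : ℝ)⁻¹

/-- `-½ ∑_r ∑_s H^{rs}(θ) E_θ{A_{n,rs}(θ)}`, for a given non-stochastic matrix `Hbar = H(θ)`. -/
def phi (Hbar : Matrix (Fin p) (Fin p) ℝ) (θ : Fin p → ℝ) (n : ℕ) : Fin p → ℝ := fun v =>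
  -(1 / 2 * ∑ r, ∑ s, Hbar⁻¹ r s * ∫ x, M.A n x θ r s v ∂(M.law θ n))

/-- `τ` is a maximum likelihood estimate for the data `x`, solving the likelihood equation. -/
structure IsMLE (n : ℕ) (x : Fin n → 𝒳) (τ : Fin p → ℝ) : Prop where
  mem : τ ∈ interior M.Θ
  isMax : ∀ τ' ∈ M.Θ, M.f n τ' x ≤ M.f n τ x
  score_eq_zero : ∀ r, pd r (M.logLik n x) τ = 0

/-- The regularity conditions at the true parameter `θ`. That the maximum likelihood estimate
exists and that `H_n` is positive definite there is only required with probability tending to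
one. The prior may depend on `n`. -/
structure Regular (π : ℕ → (Fin p → ℝ) → ℝ) (mle : ∀ n, (Fin n → 𝒳) → (Fin p → ℝ))
    (θ : Fin p → ℝ) : Prop where
  mle_rate : IsBigOInProb (M.law θ) (fun n x => mle n x - θ) (fun n => (√(n : ℝ))⁻¹)
  logLik_rate : IsBigOInProb (M.law θ) (fun n x => M.logLik n x θ) (fun n => (n : ℝ))
  logLik_smooth : ∀ᶠ n in atTop, ∀ᵐ x ∂(M.law θ n),
    (∀ τ ∈ interior M.Θ, 0 < M.f n τ x) ∧ ContDiffOn ℝ 3 (M.logLik n x) (interior M.Θ)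
  prior_nonneg : ∀ n, ∀ τ ∈ M.Θ, 0 ≤ π n τ
  prior_pos : ∀ n, 0 < π n θ
  prior_diff : ∀ n, DifferentiableOn ℝ (π n) (interior M.Θ)
  H_invertible : ∀ᶠ n in atTop, ∀ᵐ x ∂(M.law θ n), IsUnit (M.H n x θ)
  mle_posDef : Tendsto
    (fun n => M.law θ n {x | ¬ (M.IsMLE n x (mle n x) ∧ (M.H n x (mle n x)).PosDef)})
    atTop (𝓝 0)

end ParamModel

end

/-! Part (a) is bookkeeping: the leading term is an affine combination of the posterior mean and the
remainder, hence integrable, and taking expectations leaves exactly the expectation of the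
remainder. The substance of (b) is that the score is centred and square integrable, although no
differentiation under the integral sign is assumed. With a deterministic Hessian, the log-likelihood
ratio along a coordinate line is `t * X + h t`, with `X` the score at `θ` and `h` deterministic, `h
0 = h' 0 = 0`. Likelihood ratios have expectation at most one, so `X` has exponential moments near
zero and `mgf X t * exp (h t) ≤ 1`. Equality holds at `t = 0`, an interior maximum, and the
vanishing derivative there reads `E X = 0`. Then `I` is a product of two square-integrable scores,
`J` a constant times a score, `K` a derivative of the deterministic Hessian; so `A` is integrable
and the score drops out of the expected leading term. -/

noncomputable section

/-- A score whose log-likelihood has a deterministic second derivative is square integrable and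
centred, as soon as the likelihood ratios have expectation at most one. -/
theorem memLp_two_and_integral_eq_zero_of_deriv_deterministic {Ω : Type*} [MeasurableSpace Ω]
    {P : Measure Ω} [IsProbabilityMeasure P] {φ φ' : Ω → ℝ → ℝ} {c : ℝ → ℝ} {δ : ℝ} (hδ : 0 < δ)
    (hmeas : ∀ t ∈ Set.Ioo (-δ) δ, Measurable fun ω => φ ω t)
    (hφ : ∀ᵐ ω ∂P, ∀ t ∈ Set.Ioo (-δ) δ,
      HasDerivAt (φ ω) (φ' ω t) t ∧ HasDerivAt (φ' ω) (c t) t)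
    (hle : ∀ t ∈ Set.Ioo (-δ) δ,
      ∫⁻ ω, ENNReal.ofReal (Real.exp (φ ω t - φ ω 0)) ∂P ≤ 1) :
    MemLp (fun ω => φ' ω 0) 2 P ∧ ∫ ω, φ' ω 0 ∂P = 0 := by
  have h0 : (0 : ℝ) ∈ Set.Ioo (-δ) δ := ⟨by linarith, hδ⟩
  -- A reference sample: subtracting its log-likelihood cancels the common curvature `c`, so `c`
  -- never has to be integrated.
  obtain ⟨ω₀, hω₀⟩ := hφ.exists
  set X : Ω → ℝ := fun ω => φ' ω 0 with hX
  set h : ℝ → ℝ := fun t => φ ω₀ t - φ ω₀ 0 - t * φ' ω₀ 0 with hh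
  have hderiv : HasDerivAt h 0 0 := by
    have := ((hω₀ 0 h0).1.sub_const (φ ω₀ 0)).sub ((hasDerivAt_id (0 : ℝ)).mul_const (φ' ω₀ 0))
    rwa [one_mul, sub_self] at this
  have haff : ∀ᵐ ω ∂P, ∀ t ∈ Set.Ioo (-δ) δ, φ ω t - φ ω 0 = t * X ω + h t := by
    filter_upwards [hφ] with ω hω t ht
    have h1 : ∀ s ∈ Set.Ioo (-δ) δ, φ' ω s - φ' ω₀ s = φ' ω 0 - φ' ω₀ 0 := by
      intro s hs
      refine isOpen_Ioo.is_const_of_deriv_eq_zero isPreconnected_Ioo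
        (f := fun s => φ' ω s - φ' ω₀ s) ?_ ?_ hs h0
      · exact fun u hu =>
          ((hω u hu).2.sub (hω₀ u hu).2).differentiableAt.differentiableWithinAt
      · intro u hu
        exact ((hω u hu).2.sub (hω₀ u hu).2).deriv.trans (sub_self _)
    have h2 := isOpen_Ioo.is_const_of_deriv_eq_zero isPreconnected_Ioo
        (f := fun s => φ ω s - φ ω₀ s - s * (φ' ω 0 - φ' ω₀ 0)) (s := Set.Ioo (-δ) δ)
        (fun u hu => (((hω u hu).1.sub (hω₀ u hu).1).sub
          ((hasDerivAt_id u).mul_const _)).differentiableAt.differentiableWithinAt)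
        (fun u hu => by
          have := (((hω u hu).1.sub (hω₀ u hu).1).sub
            ((hasDerivAt_id u).mul_const (φ' ω 0 - φ' ω₀ 0))).deriv
          refine this.trans ?_
          simp [h1 u hu]) ht h0
    simp only [hh, hX]
    linarith
  -- Measurability of the score is not assumed; it is an almost sure limit of difference quotients.
  -- The shift by 2 keeps even `u 0 = δ / 2` inside the open interval.
  have hXm : AEMeasurable X P := by
    let u : ℕ → ℝ := fun k => δ / (k + 2)
    have hu : ∀ k, u k ∈ Set.Ioo (-δ) δ := fun k => by
      have hk : (0 : ℝ) < k + 2 := by positivity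
      refine ⟨lt_trans (by linarith) (div_pos hδ hk), ?_⟩
      rw [div_lt_iff₀ hk]
      nlinarith [(Nat.cast_nonneg k : (0 : ℝ) ≤ k)]
    have hu0 : ∀ k, u k ≠ 0 := fun k => by positivity
    have hut : Tendsto u atTop (𝓝[≠] 0) := by
      refine tendsto_nhdsWithin_iff.2 ⟨?_, Eventually.of_forall hu0⟩
      exact tendsto_const_nhds.div_atTop
        (tendsto_atTop_add_const_right _ _ tendsto_natCast_atTop_atTop)
    refine aemeasurable_of_tendsto_metrizable_ae (u := atTop)
      (f := fun k ω => (u k)⁻¹ * (φ ω (u k) - φ ω 0)) (fun k =>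
        (((hmeas _ (hu k)).sub (hmeas 0 h0)).const_mul _).aemeasurable) ?_
    filter_upwards [hφ] with ω hω
    have := (hasDerivAt_iff_tendsto_slope.1 (hω 0 h0).1).comp hut
    refine this.congr fun k => ?_
    simp [slope_def_field, div_eq_inv_mul]
  have hlint : ∀ t ∈ Set.Ioo (-δ) δ,
      ∫⁻ ω, ENNReal.ofReal (Real.exp (t * X ω + h t)) ∂P ≤ 1 := fun t ht => by
    refine le_trans (le_of_eq (lintegral_congr_ae ?_)) (hle t ht)
    filter_upwards [haff] with ω hω
    rw [hω t ht]
  have hint' : ∀ t ∈ Set.Ioo (-δ) δ, Integrable (fun ω => Real.exp (t * X ω + h t)) P :=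
    fun t ht => by
      refine ⟨(((hXm.const_mul t).add_const _).exp).aestronglyMeasurable, ?_⟩
      rw [hasFiniteIntegral_iff_ofReal (Eventually.of_forall fun _ => (Real.exp_pos _).le)]
      exact (hlint t ht).trans_lt ENNReal.one_lt_top
  have hint : ∀ t ∈ Set.Ioo (-δ) δ, Integrable (fun ω => Real.exp (t * X ω)) P := fun t ht => by
    have := (hint' t ht).const_mul (Real.exp (-h t))
    refine this.congr (Eventually.of_forall fun ω => ?_)
    simp only [← Real.exp_add]
    congr 1; ring
  have hmgf : ∀ t ∈ Set.Ioo (-δ) δ, ProbabilityTheory.mgf X P t * Real.exp (h t) ≤ 1 :=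
    fun t ht => by
      have h1 : ProbabilityTheory.mgf X P t * Real.exp (h t)
          = ∫ ω, Real.exp (t * X ω + h t) ∂P := by
        simp only [ProbabilityTheory.mgf, Real.exp_add, integral_mul_const]
      rw [h1, integral_eq_lintegral_of_nonneg_ae
        (Eventually.of_forall fun _ => (Real.exp_pos _).le) (hint' t ht).aestronglyMeasurable]
      exact ENNReal.toReal_le_of_le_ofReal zero_le_one (by simpa using hlint t ht)
  have hmem : (0 : ℝ) ∈ interior (ProbabilityTheory.integrableExpSet X P) :=
    mem_interior.2 ⟨_, fun t ht => hint t ht, isOpen_Ioo, h0⟩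
  refine ⟨by exact_mod_cast ProbabilityTheory.memLp_of_mem_interior_integrableExpSet hmem 2, ?_⟩
  -- The derivative at 0 is `E X`, because `h 0 = 0` and `h' 0 = 0`; the bound `hmgf` makes 0 a
  -- local maximum.
  have hd := (ProbabilityTheory.hasDerivAt_mgf hmem).mul hderiv.exp
  have hmax : IsLocalMax (fun t => ProbabilityTheory.mgf X P t * Real.exp (h t)) 0 := by
    filter_upwards [isOpen_Ioo.mem_nhds h0] with t ht
    refine (hmgf t ht).trans (le_of_eq ?_)
    simp [hh]
  have := hmax.hasDerivAt_eq_zero hd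
  simpa [hh] using this

/-! ### Partial derivatives along coordinate lines -/

theorem ContDiffOn.pd {p : ℕ} {g : (Fin p → ℝ) → ℝ} {U : Set (Fin p → ℝ)} (hU : IsOpen U)
    {m n : WithTop ℕ∞} (hg : ContDiffOn ℝ n g U) (hmn : m + 1 ≤ n) (r : Fin p) :
    ContDiffOn ℝ m (pd r g) U :=
  (hg.fderiv_of_isOpen hU hmn).clm_apply contDiffOn_const

theorem hasDerivAt_pd {p : ℕ} {g : (Fin p → ℝ) → ℝ} {θ : Fin p → ℝ} {t : ℝ} {r : Fin p}
    (hg : DifferentiableAt ℝ g (θ + t • Pi.single r 1)) :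
    HasDerivAt (fun t : ℝ => g (θ + t • Pi.single r 1)) (pd r g (θ + t • Pi.single r 1)) t := by
  have h1 : HasDerivAt (fun t : ℝ => θ + t • (Pi.single r 1 : Fin p → ℝ)) (Pi.single r 1) t := by
    simpa using ((hasDerivAt_id t).smul_const (Pi.single r 1 : Fin p → ℝ)).const_add θ
  exact hg.hasFDerivAt.comp_hasDerivAt t h1

/-! ### Non-stochastic Hessian and moments of the score -/

namespace ParamModel

variable {𝒳 : Type*} [MeasurableSpace 𝒳] {p : ℕ} (M : ParamModel 𝒳 p)

theorem isProbabilityMeasure_law {θ : Fin p → ℝ} (hθ : θ ∈ M.Θ) (n : ℕ) :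
    IsProbabilityMeasure (M.law θ n) :=
  ⟨by rw [law, withDensity_apply _ MeasurableSet.univ, Measure.restrict_univ,
    M.f_lintegral n θ hθ]⟩

/-- Only an inequality: the mass that `f n τ` puts where `f n θ` vanishes is lost. No common support
is needed. -/
theorem lintegral_ratio_le_one {θ τ : Fin p → ℝ} (hθ : θ ∈ M.Θ) (hτ : τ ∈ M.Θ) (n : ℕ) :
    ∫⁻ x, ENNReal.ofReal (M.f n τ x / M.f n θ x) ∂(M.law θ n) ≤ 1 := by
  have hm : Measurable fun x => ENNReal.ofReal (M.f n τ x / M.f n θ x) :=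
    ((M.f_measurable n τ hτ).div (M.f_measurable n θ hθ)).ennreal_ofReal
  rw [law, lintegral_withDensity_eq_lintegral_mul _ (M.f_measurable n θ hθ).ennreal_ofReal hm,
    ← M.f_lintegral n τ hτ]
  refine lintegral_mono fun x => ?_
  simp only [Pi.mul_apply]
  rw [← ENNReal.ofReal_mul (M.f_nonneg n θ hθ x)]
  refine ENNReal.ofReal_le_ofReal ?_
  rcases (M.f_nonneg n θ hθ x).eq_or_lt' with h | h
  · simpa [h] using M.f_nonneg n τ hτ x
  · rw [mul_div_cancel₀ _ h.ne']

/-- For the data `x` the likelihood is positive and `C³` in the interior of `Θ`. -/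
def SmoothAt (n : ℕ) (x : Fin n → 𝒳) : Prop :=
  (∀ τ ∈ interior M.Θ, 0 < M.f n τ x) ∧ ContDiffOn ℝ 3 (M.logLik n x) (interior M.Θ)

variable {M} in
theorem SmoothAt.continuousOn_H {n : ℕ} {x : Fin n → 𝒳} (h : M.SmoothAt n x) :
    ContinuousOn (M.H n x) (interior M.Θ) := by
  refine continuousOn_pi.2 fun r => continuousOn_pi.2 fun s => ?_
  have h1 : ContDiffOn ℝ 2 (pd s (M.logLik n x)) (interior M.Θ) :=
    h.2.pd isOpen_interior (by norm_num) s
  have h2 : ContDiffOn ℝ 1 (pd r (pd s (M.logLik n x))) (interior M.Θ) :=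
    h1.pd isOpen_interior (by norm_num) r
  exact (h2.continuousOn.const_smul ((n : ℝ)⁻¹)).neg

/-- A Hessian that is non-stochastic at each point is almost surely a non-stochastic function. -/
theorem ae_eqOn_H {θ : Fin p → ℝ} (hθ : θ ∈ M.Θ) {n : ℕ}
    (hs : ∀ᵐ x ∂(M.law θ n), M.SmoothAt n x) {Hbar : (Fin p → ℝ) → Matrix (Fin p) (Fin p) ℝ}
    (hH : ∀ τ ∈ interior M.Θ, ∀ᵐ x ∂(M.law θ n), M.H n x τ = Hbar τ) :
    ∀ᵐ x ∂(M.law θ n), Set.EqOn (M.H n x) Hbar (interior M.Θ) := by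
  have := M.isProbabilityMeasure_law hθ n
  obtain ⟨D, hDc, hDd⟩ := TopologicalSpace.exists_countable_dense (Fin p → ℝ)
  -- The null set in `hH` depends on `τ`; a countable dense set allows a single one.
  have hD : ∀ᵐ x ∂(M.law θ n), ∀ τ ∈ interior M.Θ ∩ D, M.H n x τ = Hbar τ :=
    (ae_ball_iff (hDc.mono Set.inter_subset_right)).2 fun τ hτ => hH τ hτ.1
  filter_upwards [hs, hD] with x hx hxD τ hτ
  -- `Hbar` is not known to be continuous, so `H n x` is compared with `H n y` for a second sample
  -- `y` chosen to match `Hbar` at this `τ`.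
  obtain ⟨y, hy, hyD, hyτ⟩ := (hs.and (hD.and (hH τ hτ))).exists
  rw [← hyτ]
  exact Set.EqOn.of_subset_closure (fun σ hσ => (hxD σ hσ).trans (hyD σ hσ).symm)
    hx.continuousOn_H hy.continuousOn_H Set.inter_subset_left
    (hDd.open_subset_closure_inter isOpen_interior) hτ

variable {M} in
theorem pd_pd_logLik_eq {n : ℕ} (hn : n ≠ 0) (x : Fin n → 𝒳) (τ : Fin p → ℝ) (r s : Fin p) :
    pd r (pd s (M.logLik n x)) τ = -(n * M.H n x τ r s) := by
  have : (n : ℝ) ≠ 0 := Nat.cast_ne_zero.2 hn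
  simp [H, this]

theorem memLp_score_and_integral_eq_zero {θ : Fin p → ℝ} (hθ : θ ∈ interior M.Θ) {n : ℕ}
    (hn : n ≠ 0) (hs : ∀ᵐ x ∂(M.law θ n), M.SmoothAt n x)
    {Hbar : (Fin p → ℝ) → Matrix (Fin p) (Fin p) ℝ}
    (hH : ∀ᵐ x ∂(M.law θ n), Set.EqOn (M.H n x) Hbar (interior M.Θ)) (r : Fin p) :
    MemLp (fun x => pd r (M.logLik n x) θ) 2 (M.law θ n) ∧
      ∫ x, pd r (M.logLik n x) θ ∂(M.law θ n) = 0 := by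
  have := M.isProbabilityMeasure_law (interior_subset hθ) n
  have hcont : Continuous fun t : ℝ => θ + t • (Pi.single r 1 : Fin p → ℝ) := by fun_prop
  obtain ⟨δ, hδ, hball⟩ := Metric.mem_nhds_iff.1
    ((isOpen_interior.preimage hcont).mem_nhds (show (0 : ℝ) ∈ _ by simpa using hθ))
  have hin : ∀ t ∈ Set.Ioo (-δ) δ, θ + t • (Pi.single r 1 : Fin p → ℝ) ∈ interior M.Θ :=
    fun t ht => hball (by simpa [abs_lt] using ht)
  have key := memLp_two_and_integral_eq_zero_of_deriv_deterministic (P := M.law θ n)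
    (φ := fun x t => M.logLik n x (θ + t • Pi.single r 1))
    (φ' := fun x t => pd r (M.logLik n x) (θ + t • Pi.single r 1))
    (c := fun t => -(n * Hbar (θ + t • Pi.single r 1) r r)) hδ
    (fun t ht => (M.f_measurable n _ (interior_subset (hin t ht))).log) ?_ ?_
  · simpa using key
  · filter_upwards [hs, hH] with x hx hxH t ht
    have hnhds := isOpen_interior.mem_nhds (hin t ht)
    refine ⟨hasDerivAt_pd ((hx.2.contDiffAt hnhds).differentiableAt (by norm_num)), ?_⟩
    rw [← hxH (hin t ht), ← pd_pd_logLik_eq hn]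
    have h1 : ContDiffOn ℝ 2 (pd r (M.logLik n x)) (interior M.Θ) :=
      hx.2.pd isOpen_interior (by norm_num) r
    exact hasDerivAt_pd ((h1.contDiffAt hnhds).differentiableAt (by norm_num))
  · intro t ht
    refine le_trans (le_of_eq (lintegral_congr_ae ?_))
      (M.lintegral_ratio_le_one (interior_subset hθ) (interior_subset (hin t ht)) n)
    filter_upwards [hs] with x hx
    simp only [logLik, zero_smul, add_zero, Real.exp_sub, Real.exp_log (hx.1 _ hθ),
      Real.exp_log (hx.1 _ (hin t ht))]

end ParamModel
end

/-! ### Expectations of the terms of the expansion -/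

noncomputable section

theorem integral_sum_sum {Ω ι κ : Type*} [MeasurableSpace Ω] [Fintype ι] [Fintype κ]
    {P : Measure Ω} {F : ι → κ → Ω → ℝ} (hF : ∀ i j, Integrable (F i j) P) :
    ∫ ω, ∑ i, ∑ j, F i j ω ∂P = ∑ i, ∑ j, ∫ ω, F i j ω ∂P := by
  rw [integral_finsetSum _ fun i _ => integrable_finsetSum _ fun j _ => hF i j]
  exact Finset.sum_congr rfl fun i _ => integral_finsetSum _ fun j _ => hF i j

theorem integral_mulVec {Ω ι : Type*} [MeasurableSpace Ω] [Fintype ι] {P : Measure Ω}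
    (N : Matrix ι ι ℝ) {b : Ω → ι → ℝ} (hb : ∀ i, Integrable (fun ω => b ω i) P) :
    ∫ ω, N.mulVec (b ω) ∂P = N.mulVec fun i => ∫ ω, b ω i ∂P := by
  funext w
  have hint : ∀ i, Integrable (fun ω => N.mulVec (b ω) i) P := fun i =>
    integrable_finsetSum _ fun v _ => (hb v).const_mul (N i v)
  rw [eval_integral hint]
  simp only [Matrix.mulVec, dotProduct]
  rw [integral_finsetSum _ fun v _ => (hb v).const_mul (N w v)]
  exact Finset.sum_congr rfl fun v _ => integral_const_mul _ _

/-- Solving the expansion for `L` makes its integrability a conclusion; this needs `c ≠ 0`. -/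
theorem integrable_and_integral_of_expansion {Ω E : Type*} [MeasurableSpace Ω]
    [NormedAddCommGroup E] [NormedSpace ℝ E] [CompleteSpace E] {P : Measure Ω}
    [IsProbabilityMeasure P] {B L R : Ω → E} {θ : E} {c : ℝ} (hc : c ≠ 0)
    (hR : ∀ ω, R ω = B ω - (θ + c • L ω)) (hB : Integrable B P) (hRi : Integrable R P) :
    Integrable L P ∧ ∫ ω, B ω ∂P - θ - c • ∫ ω, L ω ∂P = ∫ ω, R ω ∂P := by
  have hL : Integrable L P := by
    have h : Integrable (fun ω => c⁻¹ • (B ω - θ - R ω)) P :=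
      ((hB.sub (integrable_const θ)).sub hRi).smul c⁻¹
    refine h.congr (Eventually.of_forall fun ω => ?_)
    have : B ω - θ - R ω = c • L ω := by rw [hR]; abel
    simp only [this, inv_smul_smul₀ hc]
  have h2 : Integrable (fun ω => c • L ω) P := hL.smul c
  have h3 : Integrable (fun ω => θ + c • L ω) P := (integrable_const θ).add h2
  refine ⟨hL, ?_⟩
  simp only [hR]
  rw [integral_sub hB h3, integral_add (integrable_const θ) h2, integral_smul]
  simp [sub_sub]

namespace ParamModel

variable {𝒳 : Type*} [MeasurableSpace 𝒳] {p : ℕ} (M : ParamModel 𝒳 p)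

variable {M} in
/-- The third derivatives of the log-likelihood are determined by the Hessian near `θ`. -/
theorem K_eq_of_eqOn_H {θ : Fin p → ℝ} (hθ : θ ∈ interior M.Θ) {n : ℕ} (hn : n ≠ 0)
    {x : Fin n → 𝒳} {Hbar : (Fin p → ℝ) → Matrix (Fin p) (Fin p) ℝ}
    (hH : Set.EqOn (M.H n x) Hbar (interior M.Θ)) (r s t : Fin p) :
    M.K n x θ r s t = (n : ℝ)⁻¹ * pd r (fun τ => -(n * Hbar τ s t)) θ := by
  have : pd s (pd t (M.logLik n x)) =ᶠ[𝓝 θ] fun τ => -(n * Hbar τ s t) := by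
    filter_upwards [isOpen_interior.mem_nhds hθ] with τ hτ
    rw [pd_pd_logLik_eq hn, hH hτ]
  rw [K, pd, pd, this.fderiv_eq]

/-- The moments of the score-dependent quantities when `H_n` is non-stochastic. -/
theorem integrable_and_integral_A {θ : Fin p → ℝ} (hθ : θ ∈ interior M.Θ) {n : ℕ} (hn : n ≠ 0)
    (hs : ∀ᵐ x ∂(M.law θ n), M.SmoothAt n x)
    {Hbar : (Fin p → ℝ) → Matrix (Fin p) (Fin p) ℝ}
    (hH : ∀ᵐ x ∂(M.law θ n), Set.EqOn (M.H n x) Hbar (interior M.Θ))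
    {Kbar : Fin p → Fin p → Fin p → ℝ}
    (hK : ∀ᵐ x ∂(M.law θ n), ∀ r s t, M.K n x θ r s t = Kbar r s t) (r s v : Fin p) :
    Integrable (fun x => M.A n x θ r s v) (M.law θ n) ∧
    Integrable (fun x => M.J n x θ r s v) (M.law θ n) ∧
    Integrable (fun x => M.I n x θ r s) (M.law θ n) ∧
    ∫ x, M.A n x θ r s v ∂(M.law θ n)
      = Kbar v r s + 2 * ∫ x, M.J n x θ v r s ∂(M.law θ n)
        + ∑ t, ∑ u, (Hbar θ)⁻¹ t u * (∫ x, M.I n x θ s u ∂(M.law θ n)) * Kbar r t v := by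
  have := M.isProbabilityMeasure_law (interior_subset hθ) n
  have hscore := fun r => (M.memLp_score_and_integral_eq_zero hθ hn hs hH r).1
  have hI : ∀ r s, Integrable (fun x => M.I n x θ r s) (M.law θ n) := fun r s =>
    ((hscore r).integrable_mul (hscore s)).const_mul _
  -- The second-derivative factor is almost surely constant, so a first moment of the score
  -- suffices.
  have hJ : ∀ r s t, Integrable (fun x => M.J n x θ r s t) (M.law θ n) := fun r s t => by
    refine (((hscore t).integrable one_le_two).const_mul
      ((n : ℝ)⁻¹ * -(n * Hbar θ r s))).congr ?_
    filter_upwards [hH] with x hx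
    rw [J, pd_pd_logLik_eq hn, hx hθ, mul_assoc]
  have hF : ∀ t u, Integrable (fun x => (Hbar θ)⁻¹ t u * M.I n x θ s u * Kbar r t v)
      (M.law θ n) := fun t u => ((hI s u).const_mul _).mul_const _
  have hsum : Integrable (fun x => ∑ t, ∑ u, (Hbar θ)⁻¹ t u * M.I n x θ s u * Kbar r t v)
      (M.law θ n) :=
    integrable_finsetSum _ fun t _ => integrable_finsetSum _ fun u _ => hF t u
  have hKJ : Integrable (fun x => Kbar v r s + 2 * M.J n x θ v r s) (M.law θ n) :=
    (integrable_const _).add ((hJ v r s).const_mul 2)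
  have hA : (fun x => Kbar v r s + 2 * M.J n x θ v r s
      + ∑ t, ∑ u, (Hbar θ)⁻¹ t u * M.I n x θ s u * Kbar r t v)
      =ᵐ[M.law θ n] fun x => M.A n x θ r s v := by
    filter_upwards [hH, hK] with x hx hxK
    simp only [A, hx hθ, hxK]
  refine ⟨(hKJ.add hsum).congr hA, hJ r s v, hI r s, ?_⟩
  rw [← integral_congr_ae hA, integral_add hKJ hsum,
    integral_add (integrable_const _) ((hJ v r s).const_mul 2), integral_const_mul,
    integral_sum_sum hF]
  simp only [integral_mul_const, integral_const_mul, integral_const, probReal_univ, one_smul]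

/-- The expectation of the leading term when `H_n` is non-stochastic: the score drops out. -/
theorem integral_lead {θ : Fin p → ℝ} (hθ : θ ∈ interior M.Θ) {n : ℕ} (hn : n ≠ 0)
    {π : (Fin p → ℝ) → ℝ} (hπ : DifferentiableAt ℝ π θ) (hπ0 : 0 < π θ)
    (hs : ∀ᵐ x ∂(M.law θ n), M.SmoothAt n x)
    {Hbar : (Fin p → ℝ) → Matrix (Fin p) (Fin p) ℝ}
    (hH : ∀ᵐ x ∂(M.law θ n), Set.EqOn (M.H n x) Hbar (interior M.Θ))
    (hA : ∀ r s v, Integrable (fun x => M.A n x θ r s v) (M.law θ n)) :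
    ∫ x, M.lead π θ n x ∂(M.law θ n) = (Hbar θ)⁻¹.mulVec (fun v =>
      pd v (fun τ => Real.log (π τ)) θ
        + 1 / 2 * ∑ r, ∑ s, (Hbar θ)⁻¹ r s * ∫ x, M.A n x θ r s v ∂(M.law θ n)) := by
  have := M.isProbabilityMeasure_law (interior_subset hθ) n
  have hscore := M.memLp_score_and_integral_eq_zero hθ hn hs hH
  set b : (Fin n → 𝒳) → Fin p → ℝ := fun x v =>
    pd v (fun τ => Real.log (π τ)) θ + 2 * pd v (M.logLik n x) θ
      + 1 / 2 * ∑ r, ∑ s, (Hbar θ)⁻¹ r s * M.A n x θ r s v with hb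
  have hlead : M.lead π θ n =ᵐ[M.law θ n] fun x => (Hbar θ)⁻¹.mulVec (b x) := by
    filter_upwards [hs, hH] with x hx hxH
    have hl : DifferentiableAt ℝ (M.logLik n x) θ :=
      (hx.2.contDiffAt (isOpen_interior.mem_nhds hθ)).differentiableAt (by norm_num)
    rw [lead, hxH hθ]
    congr 1
    funext v
    have : pd v (fun τ => Real.log (π τ) + 2 * M.logLik n x τ) θ
        = pd v (fun τ => Real.log (π τ)) θ + 2 * pd v (M.logLik n x) θ := by
      simp only [pd]
      rw [fderiv_fun_add (hπ.log hπ0.ne') (hl.const_mul 2), fderiv_const_mul hl]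
      simp
    rw [this]
  have h1 : ∀ v, Integrable (fun x => pd v (fun τ => Real.log (π τ)) θ
      + 2 * pd v (M.logLik n x) θ) (M.law θ n) := fun v =>
    (integrable_const _).add (((hscore v).1.integrable one_le_two).const_mul 2)
  have hF : ∀ v r s, Integrable (fun x => (Hbar θ)⁻¹ r s * M.A n x θ r s v) (M.law θ n) :=
    fun v r s => (hA r s v).const_mul _
  have h2 : ∀ v, Integrable (fun x => 1 / 2 * ∑ r, ∑ s, (Hbar θ)⁻¹ r s * M.A n x θ r s v)
      (M.law θ n) := fun v =>
    (integrable_finsetSum _ fun r _ => integrable_finsetSum _ fun s _ => hF v r s).const_mul _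
  have hbint : ∀ v, Integrable (fun x => b x v) (M.law θ n) := fun v => (h1 v).add (h2 v)
  have hbE : ∀ v, ∫ x, b x v ∂(M.law θ n) = pd v (fun τ => Real.log (π τ)) θ
      + 1 / 2 * ∑ r, ∑ s, (Hbar θ)⁻¹ r s * ∫ x, M.A n x θ r s v ∂(M.law θ n) := fun v => by
    simp only [hb]
    rw [integral_add (h1 v) (h2 v), integral_add (integrable_const _)
      (((hscore v).1.integrable one_le_two).const_mul 2), integral_const_mul, (hscore v).2,
      integral_const_mul, integral_sum_sum (hF v)]
    simp only [integral_const_mul, integral_const, probReal_univ, one_smul, mul_zero, add_zero]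
  rw [integral_congr_ae hlead, integral_mulVec _ hbint]
  simp only [hbE]

theorem integrable_lead_and_bias_sub {π : (Fin p → ℝ) → ℝ} {θ : Fin p → ℝ} (hθ : θ ∈ M.Θ) {n : ℕ}
    (hn : n ≠ 0) (hbayes : Integrable (M.bayes π n) (M.law θ n))
    (hrem : Integrable (M.remainder π θ n) (M.law θ n)) :
    Integrable (M.lead π θ n) (M.law θ n) ∧
      M.bias π θ n - (n : ℝ)⁻¹ • ∫ x, M.lead π θ n x ∂(M.law θ n)
        = ∫ x, M.remainder π θ n x ∂(M.law θ n) := by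
  have := M.isProbabilityMeasure_law hθ n
  exact integrable_and_integral_of_expansion (inv_ne_zero (Nat.cast_ne_zero.2 hn))
    (fun _ => rfl) hbayes hrem

end ParamModel
end

/-! ### Assembly of the bias formulas -/

theorem mainTheorem5 {𝒳 : Type*} [MeasurableSpace 𝒳] {p : ℕ} (M : ParamModel 𝒳 p)
    (π : ℕ → (Fin p → ℝ) → ℝ) (mle : ∀ n, (Fin n → 𝒳) → (Fin p → ℝ))
    (θ : Fin p → ℝ) (hθ : θ ∈ interior M.Θ)
    (hreg : M.Regular π mle θ)
    -- the posterior mean exists and has an expectation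
    (hpost : ∀ᶠ n in atTop, ∀ᵐ x ∂(M.law θ n), M.PosteriorMeanExists (π n) n x)
    (hbayes : ∀ᶠ n in atTop, Integrable (M.bayes (π n) n) (M.law θ n))
    -- the remainder has expectation `o(n⁻¹)`
    (hrem_int : ∀ᶠ n in atTop, Integrable (M.remainder (π n) θ n) (M.law θ n))
    (hrem : (fun n => ∫ x, M.remainder (π n) θ n x ∂(M.law θ n))
      =o[atTop] fun n : ℕ => (n : ℝ)⁻¹) :
    -- the bias of the posterior mean
    ((∀ᶠ n in atTop, Integrable (M.lead (π n) θ n) (M.law θ n)) ∧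
      (fun n => M.bias (π n) θ n - (n : ℝ)⁻¹ • ∫ x, M.lead (π n) θ n x ∂(M.law θ n))
        =o[atTop] fun n : ℕ => (n : ℝ)⁻¹) ∧
    -- the case of non-stochastic `H_n`
    (∀ Hbar : ℕ → (Fin p → ℝ) → Matrix (Fin p) (Fin p) ℝ,
      (∀ᶠ n in atTop, ∀ τ ∈ interior M.Θ, ∀ᵐ x ∂(M.law θ n), M.H n x τ = Hbar n τ) →
      -- the expectations below exist
      (∀ᶠ n in atTop, ∀ r s v,
        Integrable (fun x => M.A n x θ r s v) (M.law θ n) ∧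
        Integrable (fun x => M.J n x θ r s v) (M.law θ n) ∧
        Integrable (fun x => M.I n x θ r s) (M.law θ n)) ∧
      -- the bias
      ((fun n => M.bias (π n) θ n - (n : ℝ)⁻¹ • (Hbar n θ)⁻¹.mulVec (fun v =>
          pd v (fun τ => Real.log (π n τ)) θ
            + 1 / 2 * ∑ r, ∑ s, (Hbar n θ)⁻¹ r s * ∫ x, M.A n x θ r s v ∂(M.law θ n)))
        =o[atTop] fun n : ℕ => (n : ℝ)⁻¹) ∧
      -- second-order unbiasedness under the differential equation for the prior
      ((∀ᶠ n in atTop, ∀ v, pd v (fun τ => Real.log (π n τ)) θ = M.phi (Hbar n θ) θ n v) →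
        M.SecondOrderUnbiasedAt π θ) ∧
      -- `K_n` is non-stochastic too, and the form of `E A_n`
      (∃ Kbar : ℕ → Fin p → Fin p → Fin p → ℝ,
        (∀ᶠ n in atTop, ∀ᵐ x ∂(M.law θ n), ∀ r s t, M.K n x θ r s t = Kbar n r s t) ∧
        (∀ᶠ n in atTop, ∀ r s v,
          ∫ x, M.A n x θ r s v ∂(M.law θ n)
            = Kbar n v r s + 2 * ∫ x, M.J n x θ v r s ∂(M.law θ n)
              + ∑ t, ∑ u, (Hbar n θ)⁻¹ t u * (∫ x, M.I n x θ s u ∂(M.law θ n))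
                  * Kbar n r t v))) := by
  have hmem := interior_subset hθ
  have hs : ∀ᶠ n in atTop, ∀ᵐ x ∂(M.law θ n), M.SmoothAt n x := hreg.logLik_smooth
  have hbias : (fun n => M.bias (π n) θ n - (n : ℝ)⁻¹ • ∫ x, M.lead (π n) θ n x ∂(M.law θ n))
      =o[atTop] fun n : ℕ => (n : ℝ)⁻¹ := by
    refine hrem.congr' ?_ EventuallyEq.rfl
    filter_upwards [hbayes, hrem_int, eventually_ne_atTop 0] with n h1 h2 hn
    exact (M.integrable_lead_and_bias_sub hmem hn h1 h2).2.symm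
  refine ⟨⟨?_, hbias⟩, fun Hbar hHbar => ?_⟩
  · filter_upwards [hbayes, hrem_int, eventually_ne_atTop 0] with n h1 h2 hn
    exact (M.integrable_lead_and_bias_sub hmem hn h1 h2).1
  have hH : ∀ᶠ n in atTop, ∀ᵐ x ∂(M.law θ n), Set.EqOn (M.H n x) (Hbar n) (interior M.Θ) := by
    filter_upwards [hs, hHbar] with n h1 h2 using M.ae_eqOn_H hmem h1 h2
  -- Differentiating `Hbar` is legitimate because it agrees with `H n x` on a whole neighbourhood of
  -- `θ`, for almost every `x`.
  let Kbar : ℕ → Fin p → Fin p → Fin p → ℝ := fun n r s t =>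
    (n : ℝ)⁻¹ * pd r (fun τ => -(n * Hbar n τ s t)) θ
  have hK : ∀ᶠ n in atTop, ∀ᵐ x ∂(M.law θ n), ∀ r s t, M.K n x θ r s t = Kbar n r s t := by
    filter_upwards [hH, eventually_ne_atTop 0] with n h1 hn
    filter_upwards [h1] with x hx using ParamModel.K_eq_of_eqOn_H hθ hn hx
  have hmom : ∀ᶠ n in atTop, ∀ r s v, _ :=
    (((hs.and hH).and hK).and (eventually_ne_atTop 0)).mono fun n h =>
      M.integrable_and_integral_A hθ h.2 h.1.1.1 h.1.1.2 h.1.2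
  have hbias' : (fun n => M.bias (π n) θ n - (n : ℝ)⁻¹ • (Hbar n θ)⁻¹.mulVec (fun v =>
      pd v (fun τ => Real.log (π n τ)) θ
        + 1 / 2 * ∑ r, ∑ s, (Hbar n θ)⁻¹ r s * ∫ x, M.A n x θ r s v ∂(M.law θ n)))
      =o[atTop] fun n : ℕ => (n : ℝ)⁻¹ := by
    refine hbias.congr' ?_ EventuallyEq.rfl
    filter_upwards [hs, hH, hmom, eventually_ne_atTop 0] with n h1 h2 h3 hn
    rw [M.integral_lead hθ hn ((hreg.prior_diff n).differentiableAt
      (isOpen_interior.mem_nhds hθ)) (hreg.prior_pos n) h1 h2 fun r s v => (h3 r s v).1]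
  refine ⟨?_, hbias', fun hpde => ?_, Kbar, hK, ?_⟩
  · filter_upwards [hmom] with n h r s v using ⟨(h r s v).1, (h r s v).2.1, (h r s v).2.2.1⟩
  · refine hbias'.congr' ?_ EventuallyEq.rfl
    filter_upwards [hpde] with n hn
    have : (fun v => pd v (fun τ => Real.log (π n τ)) θ
        + 1 / 2 * ∑ r, ∑ s, (Hbar n θ)⁻¹ r s * ∫ x, M.A n x θ r s v ∂(M.law θ n)) = 0 := by
      funext v
      rw [hn v, ParamModel.phi]
      exact neg_add_cancel _
    rw [this, Matrix.mulVec_zero, smul_zero, sub_zero]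
  · filter_upwards [hmom] with n h r s v using (h r s v).2.2.2
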